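/- Let $N$ be a finite set. For $a,b\in[0,1]^N$ let $a\odot b$ be the coordinate-wise product and $a\oplus b=\mathbf 1-(\mathbf 1-a)\odot(\mathbf 1-b)$. A function $F\colon[0,1]^N\to\mathbb R$ is DR-submodular if $F(a+p\mathbf 1_u)-F(a)\ge F(b+p\mathbf 1_u)-F(b)$ for all $a\le b$ in $[0,1]^N$, $u\in N$ and $p\in[0,1-b_u]$. For differentiable $F$, a vector $x$ is a local maximum with respect to $v$ if $\langle v-x,\nabla F(x)\rangle\le 0$, and a local maximum in a set $Q$ if $x\in Q$ and it is a local maximum with respect to every $v\in Q$. Let $F\colon[0,1]^N\to\mathbb R_{\ge0}$ be a non-negative differentiable DR-submodular function, let $P\subseteq[0,1]^N$ be a compact convex set that is down-closed (if $b\in P$ and $0\le a\le b$ then $a\in P$), let $o\in P$ maximize $F$ over $P$, with $F(o)>0$, and let $z\in P$, $t_s\in(0,1)$ and $\varepsilon\in(0,1/2)$. Continuous time algorithm. It receives $F,P,z,t_s,\varepsilon$ and the three numbers $F(o)$, $F(z\odot o)$, $F(z\oplus o)$. Put $$V(\tau)=\begin{cases}F(o)-F(z\odot o)-(1-e^{-\tau})F(z\oplus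 o)&\tau\in[0,t_s),\\ e^{-\tau}\left[(e^{t_s}-2\varepsilon)F(o)-(e^{t_s}-1-(\tau-t_s))F(z\oplus o)\right]&\tau\in[t_s,1),\end{cases}$$ and $z(\tau)=z$ for $\tau\in[0,t_s)$, $z(\tau)=\mathbf 0$ for $\tau\in[t_s,1)$. For $y\in[0,1]^N$ let $$Q_\tau(y)=\{v\in P:\langle(\mathbf 1-y-z(\tau))\odot\nabla F(y),v\rangle\ge V(\tau)-F(y)\}.$$ A vector $x$ is a legal direction at $(\tau,y)$ if it is a local maximum in $Q_\tau(y)$ or, in case $Q_\tau(y)=\varnothing$, if it is any vector of $P$. An execution consists of an integrable function $x(\cdot)$ on $[0,1)$ and a function $y(\cdot)$ on $[0,1]$ such that $x(\tau)$ is a legal direction at $(\tau,y(\tau))$ for every $\tau\in[0,1)$, and $y$ starts at $y(0)=\mathbf 0$ and grows at the rate $\frac{dy}{d\tau}=(\mathbf 1-y(\tau)-z(\tau))\odot x(\tau)$, i.e. $y(\tau)=\int_0^\tau(\mathbf 1-y(s)-z(s))\odot x(s)\,ds$ for all $\tau\in[0,1]$, with an integrable integrand. Its output is the vector $y(1)$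 and the function $x\colon[0,1)\to P$. Theorem. There is a legal direction at $(\tau,y)$ for all $\tau\in[0,1)$ and $y\in[0,1]^N$. Moreover, there is an absolute constant $C>0$ such that, for every input as above, every execution of the algorithm satisfies $y:=y(1)\in P$ and $x(\tau)\in P$ for all $\tau\in[0,1)$, and at least one of the following holds: * $F(y)\ge e^{-1}\left[((2-t_s)e^{t_s}-1-C\varepsilon)F(o)-(e^{t_s}-1)F(z\odot o)-\left((2-t_s)e^{t_s}-\frac{t_s^2-2t_s+5}{2}\right)F(z\oplus o)\right]$; * there is $\tau\in[t_s,1)$ such that $F(x(\tau)\oplus o)\le F(z\oplus o)-\varepsilon F(o)$ and $x(\tau)$ is a local maximum with respect to $o$. -/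

import Mathlib

open Set MeasureTheory

universe u

namespace FWMCG

/-- The coordinate-wise probabilistic sum of two vectors; the Hadamard product is the pointwise
multiplication `a * b` of functions. -/
def psum {N : Type u} (a b : N → ℝ) : N → ℝ := 1 - (1 - a) * (1 - b)

/-- DR-submodularity on the cube `[0,1]^N`: the gain of increasing one coordinate `i` by `p`
does not grow when the base point grows. -/
def DRSubmodular {N : Type u} [DecidableEq N] (F : (N → ℝ) → ℝ) : Prop :=
  ∀ a ∈ Icc (0 : N → ℝ) 1, ∀ b ∈ Icc (0 : N → ℝ) 1, a ≤ b →
    ∀ (i : N) (p : ℝ), 0 ≤ p → p ≤ 1 - b i →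
      F (b + Pi.single i p) - F b ≤ F (a + Pi.single i p) - F a

/-- `P` is down-closed: it contains every non-negative vector below one of its members. -/
def DownClosed {N : Type u} (P : Set (N → ℝ)) : Prop :=
  ∀ b ∈ P, ∀ a : N → ℝ, 0 ≤ a → a ≤ b → a ∈ P

/-- The gradient of a function on the cube `[0,1]^N` (one-sided at the boundary; the values of `F`
outside of the cube are irrelevant). -/
noncomputable def grad {N : Type u} [Fintype N] [DecidableEq N] (F : (N → ℝ) → ℝ)
    (x : N → ℝ) : N → ℝ :=
  fun i => fderivWithin ℝ F (Icc 0 1) x (Pi.single i 1)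

/-- `x` is a local maximum of `F` with respect to the vector `v`. -/
def LocalMaxWrt {N : Type u} [Fintype N] [DecidableEq N] (F : (N → ℝ) → ℝ)
    (x v : N → ℝ) : Prop :=
  (v - x) ⬝ᵥ grad F x ≤ 0

/-- `x` is a local maximum of `F` in the set `Q`. -/
def LocalMaxIn {N : Type u} [Fintype N] [DecidableEq N] (F : (N → ℝ) → ℝ)
    (Q : Set (N → ℝ)) (x : N → ℝ) : Prop :=
  x ∈ Q ∧ ∀ v ∈ Q, LocalMaxWrt F x v

/-- The threshold `V(τ)`. The algorithm knows the three numbers `vo = F(o)`, `vh = F(z ⊙ o)` and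
`vp = F(z ⊕ o)`, but not the optimal solution `o` itself. -/
noncomputable def threshold (ts ε vo vh vp τ : ℝ) : ℝ :=
  if τ < ts then vo - vh - (1 - Real.exp (-τ)) * vp
  else Real.exp (-τ) *
    ((Real.exp ts - 2 * ε) * vo - (Real.exp ts - 1 - (τ - ts)) * vp)

/-- The vector `z(τ)`: equal to `z` before time `ts` and to `0` from then on. -/
noncomputable def zAt {N : Type u} (z : N → ℝ) (ts τ : ℝ) : N → ℝ :=
  if τ < ts then z else 0

/-- The weight vector `w = (1 - y - z(τ)) ⊙ ∇F(y)` at time `τ` when the current solution is `y`. -/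
noncomputable def weight {N : Type u} [Fintype N] [DecidableEq N] (F : (N → ℝ) → ℝ)
    (z : N → ℝ) (ts τ : ℝ) (y : N → ℝ) : N → ℝ :=
  (1 - y - zAt z ts τ) * grad F y

/-- The set `Q(τ)` of the directions of `P` that are allowed at time `τ` when the current
solution is `y`. -/
def allowed {N : Type u} [Fintype N] [DecidableEq N] (F : (N → ℝ) → ℝ) (P : Set (N → ℝ))
    (z : N → ℝ) (ts ε vo vh vp τ : ℝ) (y : N → ℝ) : Set (N → ℝ) :=
  {v ∈ P | threshold ts ε vo vh vp τ - F y ≤ weight F z ts τ y ⬝ᵥ v}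

/-- The direction `x` is a legal choice at time `τ` when the current solution is `y`: a local
maximum in `Q(τ)`, or an arbitrary vector of `P` in case `Q(τ)` is empty. -/
def LegalDirection {N : Type u} [Fintype N] [DecidableEq N] (F : (N → ℝ) → ℝ)
    (P : Set (N → ℝ)) (z : N → ℝ) (ts ε vo vh vp τ : ℝ) (y x : N → ℝ) : Prop :=
  ((allowed F P z ts ε vo vh vp τ y).Nonempty →
      LocalMaxIn F (allowed F P z ts ε vo vh vp τ y) x) ∧
    (allowed F P z ts ε vo vh vp τ y = ∅ → x ∈ P)

/-- The pair `(x, y)` is an execution of the continuous time algorithm on the input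
`(F, P, z, ts, ε)`, where `vo`, `vh`, `vp` are the numbers `F(o)`, `F(z ⊙ o)`, `F(z ⊕ o)`
known to the algorithm. The integrals involved are well-defined, the direction at every time in
`[0,1)` is a legal choice, and `y` starts at `0` and grows at the rate
`dy/dτ = (1 - y(τ) - z(τ)) ⊙ x(τ)`, which is expressed in integral form since `x` is in general
not continuous. The output consists of `y 1` and the restriction of `x` to `[0,1)`. -/
structure Execution {N : Type u} [Fintype N] [DecidableEq N] (F : (N → ℝ) → ℝ)
    (P : Set (N → ℝ)) (z : N → ℝ) (ts ε vo vh vp : ℝ) (x y : ℝ → N → ℝ) : Prop where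
  direction_integrable : IntervalIntegrable x volume 0 1
  rate_integrable :
    IntervalIntegrable (fun s => (1 - y s - zAt z ts s) * x s) volume 0 1
  legal : ∀ τ ∈ Ico (0 : ℝ) 1, LegalDirection F P z ts ε vo vh vp τ (y τ) (x τ)
  growth : ∀ τ ∈ Icc (0 : ℝ) 1, y τ = ∫ s in (0 : ℝ)..τ, (1 - y s - zAt z ts s) * x s

end FWMCG

/-!
A legal direction exists since a maximizer of the continuous function `F` over the compact convex
set `Q(τ)` is a local maximum in it (`FWMCG.exists_legalDirection`).

For an execution, every coordinate of `1 - y - z(τ)` solves a linear equation `u' = -x u`, so it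
stays non-negative. Hence `y` increases, stays in the cube, and `y(1)` lies below the average of the
directions, which is in the convex set `P` (`FWMCG.Execution.output_mem`). Since the directions are
at most `1`, moreover `y(τ) ≤ (1 - e^{-τ}) (1 - z)` up to time `ts` and `y(τ) ≤ 1 - e^{-τ}`
throughout.

For the value, suppose that every direction `x(τ)`, `τ ≥ ts`, which is a local maximum with respect
to `o` satisfies `F(x(τ) ⊕ o) > F(z ⊕ o) - ε F(o)`, i.e. that the second alternative fails. The
point is that then `o ∈ Q(τ)` at any time, so that `Q(τ)` is non-empty, `x(τ)` is in it, and
`(F ∘ y)' = ⟨(1 - y - z(τ)) ⊙ ∇F(y), x⟩ ≥ V - F ∘ y`. Integrating `(eᵗ F(y))' ≥ eᵗ V` over the two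
phases yields the first alternative with the constant `C = 2`
(`FWMCG.Execution.output_value`).

By concavity along non-negative directions, `o ∈ Q(τ)` follows from
`F(y + (1 - y - z(τ)) ⊙ o) ≥ V(τ)`. Before `ts` this is a consequence of diminishing returns and of
the bound on `y` (`FWMCG.DRSubmodular.le_add_slack_mul`). From `ts` on the left-hand side is
`F(y ⊕ o)`. As long as `o ∈ Q`, the direction is a local maximum with respect to `o`, so that
`(eᵗ F(y ⊕ o))' ≥ eᵗ F(y ⊕ x ⊕ o) ≥ F(x ⊕ o) ≥ F(z ⊕ o) - ε F(o)`; integrated from `ts`, this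
exceeds `eᵗ V` by at least `ε F(o)`, as `V` contains the error `2 ε` whereas only `(1 - ts) ε` accumulates.
Because of this room, there is no first time at which `o` could leave `Q`
(`FWMCG.Execution.threshold_lt_psum`).

The function `y` is only an integral of a measurable function, so all differential inequalities hold
merely almost everywhere. They can be integrated because `y`, `F ∘ y` and `F(y ⊕ o)` are Lipschitz;
for the latter two this uses that `y` is monotone and that `F` is Lipschitz on comparable pairs
(`FWMCG.DRSubmodular.exists_lipschitz`), although `F` is not assumed to be continuously
differentiable.
-/

namespace FWMCG

variable {N : Type u} [Fintype N] [DecidableEq N]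

/-! ### DR-submodular functions along non-negative directions -/

theorem dotProduct_grad (F : (N → ℝ) → ℝ) (x d : N → ℝ) :
    d ⬝ᵥ grad F x = fderivWithin ℝ F (Icc 0 1) x d := by
  conv_rhs => rw [← Finset.univ_sum_single d, map_sum]
  refine Finset.sum_congr rfl fun i _ => ?_
  have : (Pi.single i (d i) : N → ℝ) = d i • Pi.single i 1 := by
    rw [← Pi.single_smul', smul_eq_mul, mul_one]
  rw [this, map_smul, smul_eq_mul, grad]

theorem weight_dotProduct (F : (N → ℝ) → ℝ) (z : N → ℝ) (ts τ : ℝ) (y v : N → ℝ) :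
    weight F z ts τ y ⬝ᵥ v = fderivWithin ℝ F (Icc 0 1) y ((1 - y - zAt z ts τ) * v) := by
  rw [← dotProduct_grad]
  refine Finset.sum_congr rfl fun i _ => ?_
  simp only [weight, Pi.mul_apply]
  ring

/-- The diminishing returns property for an arbitrary non-negative increment, instead of an
increment of a single coordinate. -/
theorem DRSubmodular.add_sub_le {F : (N → ℝ) → ℝ} (hF : DRSubmodular F)
    {a b d : N → ℝ} (ha : 0 ≤ a) (hab : a ≤ b) (hd : 0 ≤ d) (hbd : b + d ≤ 1) :
    F (b + d) - F b ≤ F (a + d) - F a := by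
  have key : ∀ s : Finset N,
      F (b + s.piecewise d 0) - F b ≤ F (a + s.piecewise d 0) - F a := by
    intro s
    induction s using Finset.induction_on with
    | empty => simp
    | insert i s hi ih =>
      have e : ∀ c : N → ℝ, c + (insert i s).piecewise d 0
          = (c + s.piecewise d 0) + Pi.single i (d i) := by
        intro c
        ext j
        by_cases hj : j = i
        · subst hj
          simp [Finset.piecewise, hi]
        · simp [Finset.piecewise, hj]
      have hle : ∀ j, 0 ≤ s.piecewise d 0 j ∧ s.piecewise d 0 j ≤ d j := by
        intro j
        have hdj : 0 ≤ d j := hd j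
        by_cases hj : j ∈ s <;> simp [Finset.piecewise, hj, hdj]
      have hbd' : ∀ j, 0 ≤ a j ∧ a j ≤ b j ∧ b j + d j ≤ 1 := fun j => ⟨ha j, hab j, hbd j⟩
      have h := hF (a + s.piecewise d 0) ⟨fun j => ?_, fun j => ?_⟩ (b + s.piecewise d 0)
        ⟨fun j => ?_, fun j => ?_⟩ (add_le_add_left hab _) i (d i) (hd i) ?_
      · rw [e, e]
        linarith
      iterate 4
        have h1 := hle j
        have h2 := hbd' j
        simp only [Pi.add_apply, Pi.zero_apply, Pi.one_apply]
        linarith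
      · have h2 := hbd' i
        simp only [Pi.add_apply, Finset.piecewise, hi, if_false, Pi.zero_apply]
        linarith
  simpa using key Finset.univ

theorem add_smul_mem_Icc {N : Type u} {a d : N → ℝ} (ha : 0 ≤ a) (hd : 0 ≤ d)
    (had : a + d ≤ 1) {t : ℝ} (ht : t ∈ Icc (0 : ℝ) 1) : a + t • d ∈ Icc (0 : N → ℝ) 1 := by
  refine ⟨fun i => ?_, fun i => ?_⟩ <;>
    have h1 : 0 ≤ a i := ha i <;> have h2 : 0 ≤ d i := hd i <;>
    have h3 : a i + d i ≤ 1 := had i <;>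
    simp only [Pi.add_apply, Pi.smul_apply, smul_eq_mul, Pi.zero_apply, Pi.one_apply] <;>
    nlinarith [ht.1, ht.2]

theorem hasDerivWithinAt_line {N : Type u} [Fintype N] {F : (N → ℝ) → ℝ}
    (hdiff : DifferentiableOn ℝ F (Icc 0 1)) {a d : N → ℝ} (ha : 0 ≤ a) (hd : 0 ≤ d) (had : a + d ≤ 1)
    {t : ℝ} (ht : t ∈ Icc (0 : ℝ) 1) :
    HasDerivWithinAt (fun s : ℝ => F (a + s • d))
      (fderivWithin ℝ F (Icc 0 1) (a + t • d) d) (Icc 0 1) t := by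
  have h1 := (hdiff _ (add_smul_mem_Icc ha hd had ht)).hasFDerivWithinAt
  have h2 : HasDerivWithinAt (fun s : ℝ => a + s • d) d (Icc 0 1) t := by
    simpa using ((hasDerivWithinAt_id t (Icc 0 1)).smul_const d).const_add a
  exact h1.comp_hasDerivWithinAt t h2 fun s hs => add_smul_mem_Icc ha hd had hs

/-- A differentiable DR-submodular function is concave along non-negative directions. -/
theorem DRSubmodular.concaveOn_line {F : (N → ℝ) → ℝ} (hF : DRSubmodular F)
    (hdiff : DifferentiableOn ℝ F (Icc 0 1))
    {a d : N → ℝ} (ha : 0 ≤ a) (hd : 0 ≤ d) (had : a + d ≤ 1) :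
    ConcaveOn ℝ (Icc (0 : ℝ) 1) fun t => F (a + t • d) := by
  have hderiv : ∀ t ∈ Ioo (0 : ℝ) 1, HasDerivAt (fun s : ℝ => F (a + s • d))
      (fderivWithin ℝ F (Icc 0 1) (a + t • d) d) t := fun t ht =>
    (hasDerivWithinAt_line hdiff ha hd had (Ioo_subset_Icc_self ht)).hasDerivAt
      (Icc_mem_nhds ht.1 ht.2)
  refine AntitoneOn.concaveOn_of_deriv (convex_Icc 0 1)
    (fun t ht => (hasDerivWithinAt_line hdiff ha hd had ht).continuousWithinAt) ?_ ?_
  · rw [interior_Icc]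
    exact fun t ht => (hderiv t ht).differentiableAt.differentiableWithinAt
  · rw [interior_Icc]
    intro s hs t ht hst
    rw [(hderiv s hs).deriv, (hderiv t ht).deriv]
    -- the difference quotients from the right at `t` are below those at `s`
    refine le_of_tendsto_of_tendsto (hderiv t ht).tendsto_slope_zero_right
      (hderiv s hs).tendsto_slope_zero_right ?_
    filter_upwards [Ioo_mem_nhdsGT (sub_pos.2 ht.2)] with r hr
    have hle : t + r ≤ 1 := by linarith [hr.2]
    have hd' : ∀ c : ℝ, 0 ≤ c → 0 ≤ c • d := fun c hc => smul_nonneg hc hd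
    have h := hF.add_sub_le (a := a + s • d) (b := a + t • d) (d := r • d)
      (add_nonneg ha (hd' s hs.1.le))
      (add_le_add_right (smul_le_smul_of_nonneg_right hst hd) a) (hd' r hr.1.le) (by
        rw [add_assoc, ← add_smul]
        exact (add_smul_mem_Icc ha hd had ⟨by linarith [ht.1, hr.1], hle⟩).2)
    simp only [add_assoc, ← add_smul] at h
    exact smul_le_smul_of_nonneg_left h (inv_nonneg.2 hr.1.le)

theorem DRSubmodular.sub_le_fderivWithin {F : (N → ℝ) → ℝ} (hF : DRSubmodular F)
    (hdiff : DifferentiableOn ℝ F (Icc 0 1))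
    {a d : N → ℝ} (ha : 0 ≤ a) (hd : 0 ≤ d) (had : a + d ≤ 1) :
    F (a + d) - F a ≤ fderivWithin ℝ F (Icc 0 1) a d := by
  have h := (hF.concaveOn_line hdiff ha hd had).slope_le_of_hasDerivWithinAt
    (left_mem_Icc.2 zero_le_one) (right_mem_Icc.2 zero_le_one) zero_lt_one
    (hasDerivWithinAt_line hdiff ha hd had (left_mem_Icc.2 zero_le_one))
  simpa [slope] using h

theorem DRSubmodular.fderivWithin_le_sub {F : (N → ℝ) → ℝ} (hF : DRSubmodular F)
    (hdiff : DifferentiableOn ℝ F (Icc 0 1))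
    {a d : N → ℝ} (ha : 0 ≤ a) (hd : 0 ≤ d) (had : a + d ≤ 1) :
    fderivWithin ℝ F (Icc 0 1) (a + d) d ≤ F (a + d) - F a := by
  have h := (hF.concaveOn_line hdiff ha hd had).le_slope_of_hasDerivWithinAt
    (left_mem_Icc.2 zero_le_one) (right_mem_Icc.2 zero_le_one) zero_lt_one
    (hasDerivWithinAt_line hdiff ha hd had (right_mem_Icc.2 zero_le_one))
  simpa [slope] using h

/-- If every coordinate of `a` is increased by at most a fraction `θ` of its distance to `1`, then
a non-negative DR-submodular function loses at most a fraction `θ` of its value. -/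
theorem DRSubmodular.one_sub_mul_le {F : (N → ℝ) → ℝ} (hF : DRSubmodular F)
    (hdiff : DifferentiableOn ℝ F (Icc 0 1)) (hpos : ∀ v ∈ Icc (0 : N → ℝ) 1, 0 ≤ F v)
    {a u : N → ℝ} {θ : ℝ} (ha : 0 ≤ a) (hu : 0 ≤ u) (hθ0 : 0 ≤ θ) (hθ1 : θ ≤ 1)
    (hua : ∀ i, u i ≤ θ * (1 - a i)) : (1 - θ) * F a ≤ F (a + u) := by
  rcases hθ0.eq_or_lt with rfl | hθ
  · have : u = 0 := le_antisymm (fun i => by simpa using hua i) hu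
    simp [this]
  have hd : 0 ≤ θ⁻¹ • u := smul_nonneg (inv_nonneg.2 hθ0) hu
  have had : a + θ⁻¹ • u ≤ 1 := fun i => by
    have : θ⁻¹ * u i ≤ 1 - a i := by
      rw [inv_mul_le_iff₀ hθ]
      exact hua i
    simp only [Pi.add_apply, Pi.smul_apply, smul_eq_mul, Pi.one_apply]
    linarith
  have h := (hF.concaveOn_line hdiff ha hd had).2 (left_mem_Icc.2 zero_le_one)
    (right_mem_Icc.2 zero_le_one) (sub_nonneg.2 hθ1) hθ0 (by ring)
  have h1 := hpos (a + θ⁻¹ • u) ⟨add_nonneg ha hd, had⟩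
  simp only [smul_eq_mul, zero_smul, add_zero, mul_zero, mul_one, one_smul, zero_add,
    smul_inv_smul₀ hθ.ne'] at h
  nlinarith

/-- A differentiable DR-submodular function is Lipschitz on comparable pairs of vectors: its
gradient is between the gradients at `1` and at `0`. -/
theorem DRSubmodular.exists_lipschitz {F : (N → ℝ) → ℝ} (hF : DRSubmodular F)
    (hdiff : DifferentiableOn ℝ F (Icc 0 1)) :
    ∃ L : ℝ, 0 ≤ L ∧ ∀ a b : N → ℝ, 0 ≤ a → a ≤ b → b ≤ 1 → |F b - F a| ≤ L * ‖b - a‖ := by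
  refine ⟨‖fderivWithin ℝ F (Icc 0 1) 0‖ + ‖fderivWithin ℝ F (Icc 0 1) 1‖, by positivity,
    fun a b ha hab hb => ?_⟩
  have hd : 0 ≤ b - a := sub_nonneg.2 hab
  have hd1 : b - a ≤ 1 := (sub_le_self b ha).trans hb
  have e : a + (b - a) = b := add_sub_cancel _ _
  have h1 := hF.add_sub_le le_rfl ha hd (e.trans_le hb)
  have h2 := hF.sub_le_fderivWithin hdiff le_rfl hd (by simpa using hd1)
  have h3 := hF.add_sub_le (b := 1 - (b - a)) ha
    (fun i => by have : b i ≤ 1 := hb i; simp; linarith) hd (by simp)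
  have h4 := hF.fderivWithin_le_sub hdiff (a := 1 - (b - a)) (sub_nonneg.2 hd1) hd (by simp)
  have h5 := (le_abs_self _).trans ((fderivWithin ℝ F (Icc 0 1) 0).le_opNorm (b - a))
  have h6 := (neg_le_abs _).trans ((fderivWithin ℝ F (Icc 0 1) 1).le_opNorm (b - a))
  rw [e] at h1 h3
  rw [sub_add_cancel] at h3 h4
  have h7 := norm_nonneg (b - a)
  have h8 := norm_nonneg (fderivWithin ℝ F (Icc 0 1) 0)
  have h9 := norm_nonneg (fderivWithin ℝ F (Icc 0 1) 1)
  rw [abs_le]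
  constructor <;> nlinarith [mul_nonneg h8 h7, mul_nonneg h9 h7]

/-! ### Existence of legal directions -/

/-- A maximizer of `F` over a convex subset of the cube is a local maximum in it. -/
theorem localMaxIn_of_isMaxOn {F : (N → ℝ) → ℝ} (hdiff : DifferentiableOn ℝ F (Icc 0 1))
    {Q : Set (N → ℝ)} (hQ : Convex ℝ Q) (hQ1 : Q ⊆ Icc 0 1) {x : N → ℝ} (hx : x ∈ Q)
    (hmax : IsMaxOn F Q x) : LocalMaxIn F Q x := by
  refine ⟨hx, fun v hv => ?_⟩
  rw [LocalMaxWrt, dotProduct_grad]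
  exact hmax.localize.hasFDerivWithinAt_nonpos
    ((hdiff x (hQ1 hx)).hasFDerivWithinAt.mono hQ1)
    (sub_mem_posTangentConeAt_of_segment_subset (hQ.segment_subset hx hv))

theorem exists_legalDirection {F : (N → ℝ) → ℝ} (hdiff : DifferentiableOn ℝ F (Icc 0 1))
    {P : Set (N → ℝ)} (hP1 : P ⊆ Icc 0 1) (hconv : Convex ℝ P) (hcomp : IsCompact P)
    (hne : P.Nonempty) (z : N → ℝ) (ts ε vo vh vp τ : ℝ) (w : N → ℝ) :
    ∃ v, LegalDirection F P z ts ε vo vh vp τ w v := by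
  have hlin : IsLinearMap ℝ fun v : N → ℝ => weight F z ts τ w ⬝ᵥ v :=
    ⟨fun _ _ => dotProduct_add _ _ _, fun _ _ => dotProduct_smul _ _ _⟩
  have hcont : Continuous fun v : N → ℝ => weight F z ts τ w ⬝ᵥ v := by
    unfold dotProduct
    fun_prop
  have hQconv : Convex ℝ (allowed F P z ts ε vo vh vp τ w) :=
    hconv.inter (convex_halfSpace_ge hlin _)
  have hQcomp : IsCompact (allowed F P z ts ε vo vh vp τ w) :=
    hcomp.inter_right (isClosed_le continuous_const hcont)
  have hQP : allowed F P z ts ε vo vh vp τ w ⊆ P := fun v hv => hv.1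
  rcases (allowed F P z ts ε vo vh vp τ w).eq_empty_or_nonempty with h0 | h0
  · obtain ⟨v, hv⟩ := hne
    exact ⟨v, fun h => absurd h0 h.ne_empty, fun _ => hv⟩
  · obtain ⟨v, hv, hmax⟩ :=
      hQcomp.exists_isMaxOn h0 (hdiff.continuousOn.mono (hQP.trans hP1))
    exact ⟨v, fun _ => localMaxIn_of_isMaxOn hdiff hQconv (hQP.trans hP1) hv hmax,
      fun h => absurd h h0.ne_empty⟩

/-! ### Differential inequalities that hold almost everywhere -/

theorem absolutelyContinuousOnInterval_of_abs_sub_le {f : ℝ → ℝ} {K a b : ℝ} (hK : 0 ≤ K)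
    (hab : a ≤ b) (h : ∀ s ∈ Icc a b, ∀ t ∈ Icc a b, s ≤ t → |f t - f s| ≤ K * (t - s)) :
    AbsolutelyContinuousOnInterval f a b := by
  refine LipschitzOnWith.absolutelyContinuousOnInterval (K := K.toNNReal)
    (LipschitzOnWith.of_dist_le_mul fun s hs t ht => ?_)
  rw [uIcc_of_le hab] at hs ht
  rw [Real.coe_toNNReal _ hK, Real.dist_eq, Real.dist_eq]
  rcases le_total s t with hst | hst
  · rw [abs_sub_comm (f s), abs_sub_comm s, abs_of_nonneg (sub_nonneg.2 hst)]
    exact h s hs t ht hst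
  · rw [abs_of_nonneg (sub_nonneg.2 hst)]
    exact h t ht s hs hst

theorem le_of_ae_hasDerivAt_nonneg {f : ℝ → ℝ} {a b : ℝ} (hab : a ≤ b)
    (hf : AbsolutelyContinuousOnInterval f a b)
    (h : ∀ᵐ t, t ∈ Ioo a b → ∃ f', HasDerivAt f f' t ∧ 0 ≤ f') : f a ≤ f b := by
  rw [← sub_nonneg, ← hf.integral_deriv_eq_sub, intervalIntegral.integral_of_le hab,
    integral_Ioc_eq_integral_Ioo]
  refine setIntegral_nonneg_ae measurableSet_Ioo ?_
  filter_upwards [h] with t ht htab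
  obtain ⟨f', hf', h0⟩ := ht htab
  rwa [hf'.deriv]

/-- The integrated form of the differential inequality `f' + f ≥ e⁻ᵗ k'`. -/
theorem sub_le_exp_mul_sub {f k : ℝ → ℝ} {a b : ℝ} (hab : a ≤ b)
    (hf : AbsolutelyContinuousOnInterval f a b) (hk : ContDiff ℝ 1 k)
    (h : ∀ᵐ t, t ∈ Ioo a b → ∃ f', HasDerivAt f f' t ∧ deriv k t ≤ Real.exp t * (f' + f t)) :
    k b - k a ≤ Real.exp b * f b - Real.exp a * f a := by
  have hexp : AbsolutelyContinuousOnInterval Real.exp a b :=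
    (Real.contDiff_exp.contDiffOn).absolutelyContinuousOnInterval
  have h1 := le_of_ae_hasDerivAt_nonneg hab
    ((hexp.mul hf).sub hk.contDiffOn.absolutelyContinuousOnInterval) (by
      filter_upwards [h] with t ht htab
      obtain ⟨f', hf', hle⟩ := ht htab
      refine ⟨_, ((Real.hasDerivAt_exp t).mul hf').sub
        ((hk.differentiable one_ne_zero t).hasDerivAt), ?_⟩
      linarith)
  simp only [Pi.sub_apply, Pi.mul_apply] at h1
  linarith

/-- A solution of a differential equation `f' = -c f` with `c ≥ 0` that starts non-negative stays
non-negative. -/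
theorem nonneg_of_ae_hasDerivAt {f : ℝ → ℝ} {a b : ℝ} (hab : a ≤ b)
    (hf : AbsolutelyContinuousOnInterval f a b) (h0 : 0 ≤ f a)
    (h : ∀ᵐ t, t ∈ Ioo a b → ∃ c, 0 ≤ c ∧ HasDerivAt f (-(f t * c)) t) : 0 ≤ f b := by
  by_contra! hb
  have hcont : ContinuousOn f (Icc a b) := uIcc_of_le hab ▸ hf.continuousOn
  -- `σ` is the last time at which `f` is non-negative; from then on `f` is non-decreasing
  have hS : IsCompact (Icc a b ∩ f ⁻¹' Ici 0) :=
    isCompact_Icc.of_isClosed_subset (hcont.preimage_isClosed_of_isClosed isClosed_Icc isClosed_Ici)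
      inter_subset_left
  obtain ⟨σ, ⟨hσ, hσ0⟩, hmax⟩ := hS.exists_isGreatest ⟨a, left_mem_Icc.2 hab, h0⟩
  have hle : f σ ≤ f b := by
    refine le_of_ae_hasDerivAt_nonneg hσ.2 (hf.mono ?_) ?_
    · rw [uIcc_of_le hab, uIcc_of_le hσ.2]
      exact Icc_subset_Icc_left hσ.1
    · filter_upwards [h] with t ht htσ
      obtain ⟨c, hc, hd⟩ := ht ⟨hσ.1.trans_lt htσ.1, htσ.2⟩
      refine ⟨_, hd, ?_⟩
      have hneg : f t < 0 := by
        by_contra! h1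
        exact absurd (hmax ⟨⟨hσ.1.trans htσ.1.le, htσ.2.le⟩, h1⟩) (not_le.2 htσ.1)
      nlinarith
  exact absurd (le_trans hσ0 hle) (not_le.2 hb)

/-! ### The trajectory of an execution -/

theorem zAt_nonneg {N : Type u} {z : N → ℝ} {ts : ℝ} (hz : 0 ≤ z) (t : ℝ) (i : N) :
    0 ≤ zAt z ts t i := by
  unfold zAt
  split_ifs
  · exact hz i
  · exact le_rfl

variable {F : (N → ℝ) → ℝ} {P : Set (N → ℝ)}
  {z : N → ℝ} {ts ε vo vh vp : ℝ} {x y : ℝ → N → ℝ}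

namespace Execution

theorem direction_mem (h : Execution F P z ts ε vo vh vp x y) {τ : ℝ} (hτ : τ ∈ Ico (0 : ℝ) 1) :
    x τ ∈ P := by
  rcases (allowed F P z ts ε vo vh vp τ (y τ)).eq_empty_or_nonempty with h0 | h0
  · exact (h.legal τ hτ).2 h0
  · exact ((h.legal τ hτ).1 h0).1.1

theorem start_eq_zero (h : Execution F P z ts ε vo vh vp x y) : y 0 = 0 := by
  rw [h.growth 0 (left_mem_Icc.2 zero_le_one), intervalIntegral.integral_same]

theorem exists_lipschitz (h : Execution F P z ts ε vo vh vp x y) (hP1 : P ⊆ Icc 0 1) :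
    ∃ K : ℝ, 0 ≤ K ∧ ∀ s ∈ Icc (0 : ℝ) 1, ∀ t ∈ Icc (0 : ℝ) 1, s ≤ t →
      ‖y t - y s‖ ≤ K * (t - s) := by
  have hcont : ContinuousOn y (Icc 0 1) := by
    have := intervalIntegral.continuousOn_primitive_interval' h.rate_integrable left_mem_uIcc
    rw [uIcc_of_le zero_le_one] at this
    exact this.congr h.growth
  obtain ⟨B, hB⟩ := isCompact_Icc.exists_bound_of_continuousOn hcont
  have hB0 : 0 ≤ B := (norm_nonneg _).trans (hB 0 (left_mem_Icc.2 zero_le_one))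
  refine ⟨‖(1 : N → ℝ)‖ + B + ‖z‖, by positivity, fun s hs t ht hst => ?_⟩
  have hint : ∀ r ∈ Icc (0 : ℝ) 1,
      IntervalIntegrable (fun s => (1 - y s - zAt z ts s) * x s) volume 0 r := fun r hr =>
    h.rate_integrable.mono_set (by
      rw [uIcc_of_le zero_le_one, uIcc_of_le hr.1]
      exact Icc_subset_Icc_right hr.2)
  rw [h.growth s hs, h.growth t ht,
    intervalIntegral.integral_interval_sub_left (hint t ht) (hint s hs),
    ← abs_of_nonneg (sub_nonneg.2 hst)]
  refine intervalIntegral.norm_integral_le_of_norm_le_const_ae ?_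
  filter_upwards [Measure.ae_ne volume (1 : ℝ)] with r hr1 hr
  rw [uIoc_of_le hst] at hr
  have hr01 : r ∈ Icc (0 : ℝ) 1 := ⟨hs.1.trans hr.1.le, hr.2.trans ht.2⟩
  have hx := hP1 (h.direction_mem ⟨hr01.1, lt_of_le_of_ne hr01.2 hr1⟩)
  have hx1 : ‖x r‖ ≤ 1 := (pi_norm_le_iff_of_nonneg zero_le_one).2 fun i => by
    rw [Real.norm_of_nonneg (hx.1 i)]
    exact hx.2 i
  have hz : ‖zAt z ts r‖ ≤ ‖z‖ := by
    unfold zAt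
    split_ifs <;> simp
  calc ‖(1 - y r - zAt z ts r) * x r‖ ≤ ‖1 - y r - zAt z ts r‖ * ‖x r‖ := norm_mul_le _ _
    _ ≤ ‖1 - y r - zAt z ts r‖ * 1 := by gcongr
    _ ≤ ‖(1 : N → ℝ)‖ + ‖y r‖ + ‖zAt z ts r‖ := by
      rw [mul_one]
      exact (norm_sub_le _ _).trans (add_le_add_left (norm_sub_le _ _) _)
    _ ≤ ‖(1 : N → ℝ)‖ + B + ‖z‖ := by
      gcongr
      exact hB r hr01

theorem ae_hasDerivAt (h : Execution F P z ts ε vo vh vp x y) :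
    ∀ᵐ t, t ∈ Ioo (0 : ℝ) 1 → HasDerivAt y ((1 - y t - zAt z ts t) * x t) t := by
  filter_upwards [h.rate_integrable.ae_hasDerivAt_integral] with t ht ht01
  have hd := ht (uIcc_of_le (zero_le_one (α := ℝ)) ▸ Ioo_subset_Icc_self ht01) 0 left_mem_uIcc
  refine hd.congr_of_eventuallyEq ?_
  filter_upwards [Icc_mem_nhds ht01.1 ht01.2] with s hs using h.growth s hs

theorem absolutelyContinuous_apply (h : Execution F P z ts ε vo vh vp x y) (hP1 : P ⊆ Icc 0 1)
    {a b : ℝ} (ha : 0 ≤ a) (hab : a ≤ b) (hb : b ≤ 1) (c : ℝ) (i : N) :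
    AbsolutelyContinuousOnInterval (fun t => c - y t i) a b := by
  obtain ⟨K, hK, hy⟩ := h.exists_lipschitz hP1
  refine absolutelyContinuousOnInterval_of_abs_sub_le hK hab fun s hs t ht hst => ?_
  have h1 := (norm_le_pi_norm (y t - y s) i).trans
    (hy s ⟨ha.trans hs.1, hs.2.trans hb⟩ t ⟨ha.trans ht.1, ht.2.trans hb⟩ hst)
  rw [Real.norm_eq_abs, Pi.sub_apply, abs_sub_comm] at h1
  rwa [sub_sub_sub_cancel_left]

theorem ae_hasDerivAt_apply (h : Execution F P z ts ε vo vh vp x y) (c : ℝ) (i : N) :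
    ∀ᵐ t, t ∈ Ioo (0 : ℝ) 1 →
      HasDerivAt (fun t => c - y t i) (-((1 - y t i - zAt z ts t i) * x t i)) t := by
  filter_upwards [h.ae_hasDerivAt] with t ht ht01
  exact (hasDerivAt_pi.1 (ht ht01) i).const_sub c

theorem le_one_sub (h : Execution F P z ts ε vo vh vp x y) (hP1 : P ⊆ Icc 0 1) (hz : z ≤ 1)
    (hts : ts ≤ 1) {t : ℝ} (ht : t ∈ Icc 0 ts) (i : N) : 0 ≤ 1 - z i - y t i := by
  refine nonneg_of_ae_hasDerivAt (f := fun t => 1 - z i - y t i) ht.1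
    (h.absolutelyContinuous_apply hP1 le_rfl ht.1 (ht.2.trans hts) _ i) ?_ ?_
  · have : z i ≤ 1 := hz i
    simp [h.start_eq_zero, this]
  · filter_upwards [h.ae_hasDerivAt_apply (1 - z i) i] with s hs hs01
    have hs1 : s < ts := hs01.2.trans_le ht.2
    refine ⟨x s i, (hP1 (h.direction_mem ⟨hs01.1.le, hs1.trans_le hts⟩)).1 i, ?_⟩
    convert! hs ⟨hs01.1, hs1.trans_le hts⟩ using 3
    rw [zAt, if_pos hs1]
    ring

/-- The factor `1 - y - z(τ)` of the growth rate is non-negative at any time. -/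
theorem slack_nonneg (h : Execution F P z ts ε vo vh vp x y) (hP1 : P ⊆ Icc 0 1)
    (hz : z ∈ Icc (0 : N → ℝ) 1) (hts : ts ∈ Ioo (0 : ℝ) 1) {t : ℝ} (ht : t ∈ Icc (0 : ℝ) 1)
    (i : N) : 0 ≤ 1 - y t i - zAt z ts t i := by
  rcases lt_or_ge t ts with htt | htt
  · rw [zAt, if_pos htt, sub_right_comm]
    exact h.le_one_sub hP1 hz.2 hts.2.le ⟨ht.1, htt.le⟩ i
  · rw [zAt, if_neg (not_lt.2 htt), Pi.zero_apply, sub_zero]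
    refine nonneg_of_ae_hasDerivAt (f := fun t => 1 - y t i) htt
      (h.absolutelyContinuous_apply hP1 hts.1.le htt ht.2 _ i) ?_ ?_
    · have h1 := h.le_one_sub hP1 hz.2 hts.2.le (right_mem_Icc.2 hts.1.le) i
      have h2 : 0 ≤ z i := hz.1 i
      linarith
    · filter_upwards [h.ae_hasDerivAt_apply 1 i] with s hs hs01
      have hs0 : 0 < s := hts.1.trans hs01.1
      have hs1 : s < 1 := hs01.2.trans_le ht.2
      refine ⟨x s i, (hP1 (h.direction_mem ⟨hs0.le, hs1⟩)).1 i, ?_⟩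
      convert! hs ⟨hs0, hs1⟩ using 3
      rw [zAt, if_neg (not_lt.2 hs01.1.le), Pi.zero_apply, sub_zero]

theorem mono (h : Execution F P z ts ε vo vh vp x y) (hP1 : P ⊆ Icc 0 1)
    (hz : z ∈ Icc (0 : N → ℝ) 1) (hts : ts ∈ Ioo (0 : ℝ) 1) {s t : ℝ} (hs : 0 ≤ s) (hst : s ≤ t)
    (ht : t ≤ 1) : y s ≤ y t := by
  intro i
  have h1 := le_of_ae_hasDerivAt_nonneg hst
    (h.absolutelyContinuous_apply hP1 hs hst ht 0 i).neg (by
      filter_upwards [h.ae_hasDerivAt_apply 0 i] with r hr hrst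
      have hr01 : r ∈ Ioo (0 : ℝ) 1 := ⟨hs.trans_lt hrst.1, hrst.2.trans_le ht⟩
      refine ⟨_, (hr hr01).neg, ?_⟩
      rw [neg_neg]
      exact mul_nonneg (h.slack_nonneg hP1 hz hts (Ioo_subset_Icc_self hr01) i)
        ((hP1 (h.direction_mem (Ioo_subset_Ico_self hr01))).1 i))
  simpa using h1

theorem nonneg (h : Execution F P z ts ε vo vh vp x y) (hP1 : P ⊆ Icc 0 1)
    (hz : z ∈ Icc (0 : N → ℝ) 1) (hts : ts ∈ Ioo (0 : ℝ) 1) {t : ℝ} (ht : t ∈ Icc (0 : ℝ) 1) :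
    0 ≤ y t :=
  h.start_eq_zero ▸ h.mono hP1 hz hts le_rfl ht.1 ht.2

theorem le_one (h : Execution F P z ts ε vo vh vp x y) (hP1 : P ⊆ Icc 0 1)
    (hz : z ∈ Icc (0 : N → ℝ) 1) (hts : ts ∈ Ioo (0 : ℝ) 1) {t : ℝ} (ht : t ∈ Icc (0 : ℝ) 1) :
    y t ≤ 1 := fun i => by
  have h1 := h.slack_nonneg hP1 hz hts ht i
  have h2 := zAt_nonneg (ts := ts) hz.1 t i
  rw [Pi.one_apply]
  linarith

theorem le_one_sub_exp_mul (h : Execution F P z ts ε vo vh vp x y) (hP1 : P ⊆ Icc 0 1)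
    (hz : z ≤ 1) (hts : ts ≤ 1) {t : ℝ} (ht : t ∈ Icc 0 ts) (i : N) :
    y t i ≤ (1 - Real.exp (-t)) * (1 - z i) := by
  have h1 := sub_le_exp_mul_sub (k := fun _ => 0) ht.1
    (h.absolutelyContinuous_apply hP1 le_rfl ht.1 (ht.2.trans hts) (1 - z i) i) contDiff_const (by
      filter_upwards [h.ae_hasDerivAt_apply (1 - z i) i] with s hs hs01
      have hs1 : s < ts := hs01.2.trans_le ht.2
      have hx : x s i ≤ 1 := (hP1 (h.direction_mem ⟨hs01.1.le, hs1.trans_le hts⟩)).2 i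
      have hu := h.le_one_sub hP1 hz hts ⟨hs01.1.le, hs1.le⟩ i
      refine ⟨_, hs ⟨hs01.1, hs1.trans_le hts⟩, ?_⟩
      rw [zAt, if_pos hs1, deriv_const]
      exact mul_nonneg (Real.exp_pos s).le (by nlinarith))
  simp only [h.start_eq_zero, Real.exp_zero, Pi.zero_apply] at h1
  have h2 : Real.exp (-t) * Real.exp t = 1 := by rw [← Real.exp_add]; simp
  linear_combination mul_le_mul_of_nonneg_left h1 (Real.exp_pos (-t)).le + (1 - z i - y t i) * h2

theorem le_one_sub_exp (h : Execution F P z ts ε vo vh vp x y) (hP1 : P ⊆ Icc 0 1)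
    (hz : z ∈ Icc (0 : N → ℝ) 1) (hts : ts ∈ Ioo (0 : ℝ) 1) {t : ℝ} (ht : t ∈ Icc (0 : ℝ) 1)
    (i : N) : y t i ≤ 1 - Real.exp (-t) := by
  have h1 := sub_le_exp_mul_sub (k := fun _ => 0) ht.1
    (h.absolutelyContinuous_apply hP1 le_rfl ht.1 ht.2 1 i) contDiff_const (by
      filter_upwards [h.ae_hasDerivAt_apply 1 i] with s hs hst
      have hs01 : s ∈ Ioo (0 : ℝ) 1 := ⟨hst.1, hst.2.trans_le ht.2⟩
      have hx : x s i ≤ 1 := (hP1 (h.direction_mem (Ioo_subset_Ico_self hs01))).2 i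
      have hu := h.slack_nonneg hP1 hz hts (Ioo_subset_Icc_self hs01) i
      have hz0 := zAt_nonneg (ts := ts) hz.1 s i
      refine ⟨_, hs hs01, ?_⟩
      rw [deriv_const]
      exact mul_nonneg (Real.exp_pos s).le (by nlinarith))
  simp only [h.start_eq_zero, Real.exp_zero, Pi.zero_apply] at h1
  have h2 : Real.exp (-t) * Real.exp t = 1 := by rw [← Real.exp_add]; simp
  linear_combination mul_le_mul_of_nonneg_left h1 (Real.exp_pos (-t)).le + (1 - y t i) * h2

/-- The output is feasible: it lies below the average of the directions, which is in `P`. -/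
theorem output_mem (h : Execution F P z ts ε vo vh vp x y) (hP1 : P ⊆ Icc 0 1)
    (hconv : Convex ℝ P) (hcomp : IsCompact P) (hdown : DownClosed P)
    (hz : z ∈ Icc (0 : N → ℝ) 1) (hts : ts ∈ Ioo (0 : ℝ) 1) : y 1 ∈ P := by
  have havg : (∫ s in (0 : ℝ)..1, x s) ∈ P := by
    rw [intervalIntegral.integral_of_le zero_le_one]
    have : IsProbabilityMeasure (volume.restrict (Ioc (0 : ℝ) 1)) := ⟨by simp⟩
    refine hconv.integral_mem hcomp.isClosed ?_ h.direction_integrable.1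
    rw [ae_restrict_iff' measurableSet_Ioc]
    filter_upwards [Measure.ae_ne volume (1 : ℝ)] with r hr1 hr
    exact h.direction_mem ⟨hr.1.le, lt_of_le_of_ne hr.2 hr1⟩
  refine hdown _ havg _ (h.nonneg hP1 hz hts (right_mem_Icc.2 zero_le_one)) fun i => ?_
  have e : ∀ {g : ℝ → N → ℝ}, IntervalIntegrable g volume 0 1 →
      IntervalIntegrable (fun s => g s i) volume 0 1 ∧
        (∫ s in (0 : ℝ)..1, g s) i = ∫ s in (0 : ℝ)..1, g s i := fun {g} hg =>
    ⟨⟨hg.1.eval i, hg.2.eval i⟩,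
      ((ContinuousLinearMap.proj (R := ℝ) (φ := fun _ : N => ℝ) i).intervalIntegral_comp_comm
        hg).symm⟩
  rw [h.growth 1 (right_mem_Icc.2 zero_le_one), (e h.rate_integrable).2,
    (e h.direction_integrable).2]
  refine intervalIntegral.integral_mono_on_of_le_Ioo zero_le_one (e h.rate_integrable).1
    (e h.direction_integrable).1 fun s hs => ?_
  have hx : 0 ≤ x s i := (hP1 (h.direction_mem (Ioo_subset_Ico_self hs))).1 i
  have hy : 0 ≤ y s i := h.nonneg hP1 hz hts (Ioo_subset_Icc_self hs) i
  have hz0 := zAt_nonneg (ts := ts) hz.1 s i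
  simp only [Pi.mul_apply, Pi.sub_apply, Pi.one_apply]
  nlinarith

end Execution

/-! ### Probabilistic sums and the value of the optimum after a shift -/

theorem psum_apply {N : Type u} (a b : N → ℝ) (i : N) :
    psum a b i = 1 - (1 - a i) * (1 - b i) := rfl

theorem psum_mem_Icc {N : Type u} {a b : N → ℝ} (ha : a ∈ Icc (0 : N → ℝ) 1)
    (hb : b ∈ Icc (0 : N → ℝ) 1) : psum a b ∈ Icc (0 : N → ℝ) 1 := by
  refine ⟨fun i => ?_, fun i => ?_⟩ <;>
    have h1 : 0 ≤ a i := ha.1 i <;> have h2 : a i ≤ 1 := ha.2 i <;>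
    have h3 : 0 ≤ b i := hb.1 i <;> have h4 : b i ≤ 1 := hb.2 i <;>
    simp only [psum_apply, Pi.zero_apply, Pi.one_apply] <;> nlinarith

/-- The increment `w ⊙ (1 - o)`, where `w` is at most `θ` times `1 - z`, decreases the value of any
vector below `z ⊕ o` by at most `θ F(z ⊕ o)`: by diminishing returns the loss at `z ⊕ o` is the
largest one, and `1 - z ⊕ o = (1 - z) ⊙ (1 - o)`. -/
theorem DRSubmodular.sub_mul_psum_le (hF : DRSubmodular F)
    (hdiff : DifferentiableOn ℝ F (Icc 0 1)) (hpos : ∀ v ∈ Icc (0 : N → ℝ) 1, 0 ≤ F v)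
    {z o c w : N → ℝ} {θ : ℝ} (hz : z ∈ Icc (0 : N → ℝ) 1) (ho : o ∈ Icc (0 : N → ℝ) 1)
    (hc : 0 ≤ c) (hcz : c ≤ psum z o) (hθ0 : 0 ≤ θ) (hθ1 : θ ≤ 1) (hw : 0 ≤ w)
    (hwz : ∀ i, w i ≤ θ * (1 - z i)) :
    F c - θ * F (psum z o) ≤ F (c + w * (1 - o)) := by
  have ho1 : 0 ≤ 1 - o := sub_nonneg.2 ho.2
  have hu : 0 ≤ w * (1 - o) := mul_nonneg hw ho1
  have hle : ∀ i, (w * (1 - o)) i ≤ θ * (1 - psum z o i) := fun i => by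
    have h1 : 0 ≤ 1 - o i := ho1 i
    have h2 := mul_le_mul_of_nonneg_right (hwz i) h1
    rw [psum_apply, Pi.mul_apply, Pi.sub_apply, Pi.one_apply]
    linarith
  have h1 := hF.one_sub_mul_le hdiff hpos (psum_mem_Icc hz ho).1 hu hθ0 hθ1 hle
  have h2 := hF.add_sub_le hc hcz hu (fun i => by
    have h3 := hle i
    have h4 : psum z o i ≤ 1 := (psum_mem_Icc hz ho).2 i
    rw [Pi.add_apply, Pi.one_apply]
    nlinarith)
  linarith

/-- The value after a full step from `w` towards `o` within the room left by `z`, for a vector `w`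
that itself stays within this room: the situation before time `ts`. -/
theorem DRSubmodular.le_add_slack_mul (hF : DRSubmodular F)
    (hdiff : DifferentiableOn ℝ F (Icc 0 1)) (hpos : ∀ v ∈ Icc (0 : N → ℝ) 1, 0 ≤ F v)
    {z o w : N → ℝ} {θ : ℝ} (hz : z ∈ Icc (0 : N → ℝ) 1) (ho : o ∈ Icc (0 : N → ℝ) 1)
    (hθ0 : 0 ≤ θ) (hθ1 : θ ≤ 1) (hw : 0 ≤ w) (hwz : ∀ i, w i ≤ θ * (1 - z i)) :
    F o - F (z * o) - θ * F (psum z o) ≤ F (w + (1 - w - z) * o) := by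
  have hz1 : 0 ≤ 1 - z := sub_nonneg.2 hz.2
  have hc : 0 ≤ (1 - z) * o := mul_nonneg hz1 ho.1
  have hsum : z * o + (1 - z) * o = o := by ring
  have h1 := hF.sub_mul_psum_le hdiff hpos hz ho hc (fun i => by
    have h1 : 0 ≤ z i := hz.1 i
    simp only [psum_apply, Pi.mul_apply, Pi.sub_apply, Pi.one_apply]
    linarith) hθ0 hθ1 hw hwz
  have h2 := hF.add_sub_le le_rfl (mul_nonneg hz.1 ho.1) hc (hsum.trans_le ho.2)
  have h3 := hpos 0 ⟨le_rfl, zero_le_one⟩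
  have e : w + (1 - w - z) * o = (1 - z) * o + w * (1 - o) := by ring
  rw [hsum, zero_add] at h2
  rw [e]
  linarith

/-- The value of the probabilistic sum of `o` with a vector that stays within the room left by `z`:
the situation at time `ts`, when `z(τ)` becomes `0`. -/
theorem DRSubmodular.le_psum (hF : DRSubmodular F)
    (hdiff : DifferentiableOn ℝ F (Icc 0 1)) (hpos : ∀ v ∈ Icc (0 : N → ℝ) 1, 0 ≤ F v)
    {z o w : N → ℝ} {θ : ℝ} (hz : z ∈ Icc (0 : N → ℝ) 1) (ho : o ∈ Icc (0 : N → ℝ) 1)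
    (hθ0 : 0 ≤ θ) (hθ1 : θ ≤ 1) (hw : 0 ≤ w) (hwz : ∀ i, w i ≤ θ * (1 - z i)) :
    F o - θ * F (psum z o) ≤ F (psum w o) := by
  have h1 := hF.sub_mul_psum_le hdiff hpos hz ho ho.1 (fun i => by
    have h1 : 0 ≤ z i := hz.1 i
    have h2 : o i ≤ 1 := ho.2 i
    rw [psum_apply]
    nlinarith) hθ0 hθ1 hw hwz
  have e : psum w o = o + w * (1 - o) := by
    unfold psum
    ring
  rwa [e]

/-! ### Growth of the objective along a trajectory -/

namespace Execution

variable {o : N → ℝ}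

/-- The rate of growth of `F ∘ y`, integrated with the weight `eᵗ`: if the direction is allowed at
every time in `(a, b)`, then `F ∘ y` satisfies `(F ∘ y)' + F ∘ y ≥ V`. -/
theorem sub_le_exp_mul_value_sub (h : Execution F P z ts ε vo vh vp x y) (hF : DRSubmodular F)
    (hdiff : DifferentiableOn ℝ F (Icc 0 1)) (hP1 : P ⊆ Icc 0 1)
    (hz : z ∈ Icc (0 : N → ℝ) 1) (hts : ts ∈ Ioo (0 : ℝ) 1) {a b : ℝ} (ha : 0 ≤ a) (hab : a ≤ b)
    (hb : b ≤ 1) {k : ℝ → ℝ} (hk : ContDiff ℝ 1 k)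
    (hkV : ∀ t ∈ Ioo a b, deriv k t = Real.exp t * threshold ts ε vo vh vp t)
    (hx : ∀ t ∈ Ioo a b, x t ∈ allowed F P z ts ε vo vh vp t (y t)) :
    k b - k a ≤ Real.exp b * F (y b) - Real.exp a * F (y a) := by
  obtain ⟨L, hL, hFL⟩ := hF.exists_lipschitz hdiff
  obtain ⟨K, hK, hyK⟩ := h.exists_lipschitz hP1
  have hmem : ∀ t ∈ Icc (0 : ℝ) 1, y t ∈ Icc (0 : N → ℝ) 1 := fun t ht =>
    ⟨h.nonneg hP1 hz hts ht, h.le_one hP1 hz hts ht⟩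
  refine sub_le_exp_mul_sub (f := fun t => F (y t)) hab
    (absolutelyContinuousOnInterval_of_abs_sub_le (mul_nonneg hL hK) hab
      fun s hs t ht hst => ?_) hk ?_
  · have hs0 := ha.trans hs.1
    have ht1 := ht.2.trans hb
    refine (hFL _ _ (hmem s ⟨hs0, hst.trans ht1⟩).1 (h.mono hP1 hz hts hs0 hst ht1)
      (hmem t ⟨hs0.trans hst, ht1⟩).2).trans ?_
    rw [mul_assoc]
    exact mul_le_mul_of_nonneg_left (hyK s ⟨hs0, hst.trans ht1⟩ t ⟨hs0.trans hst, ht1⟩ hst) hL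
  · filter_upwards [h.ae_hasDerivAt] with t ht htab
    have ht01 : t ∈ Ioo (0 : ℝ) 1 := ⟨ha.trans_lt htab.1, htab.2.trans_le hb⟩
    refine ⟨_, ((hdiff _ (hmem t (Ioo_subset_Icc_self ht01))).hasFDerivWithinAt).comp_hasDerivAt t
      (ht ht01) ?_, ?_⟩
    · filter_upwards [Icc_mem_nhds ht01.1 ht01.2] with s hs using hmem s hs
    · rw [hkV t htab, ← weight_dotProduct]
      have := (hx t htab).2
      exact mul_le_mul_of_nonneg_left (by linarith) (Real.exp_pos t).le

/-- The growth of `F(y ⊕ o)`, integrated with the weight `eᵗ`, over a period in which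
`F(x(t) ⊕ o) ≥ m` and `z(t) = 0`. It comes from `(F(y ⊕ o))' ≥ F(y ⊕ x ⊕ o) - F(y ⊕ o)` and
`F(y ⊕ x ⊕ o) ≥ e⁻ᵗ F(x ⊕ o)`. -/
theorem mul_le_exp_mul_psum_sub (h : Execution F P z ts ε vo vh vp x y) (hF : DRSubmodular F)
    (hdiff : DifferentiableOn ℝ F (Icc 0 1)) (hpos : ∀ v ∈ Icc (0 : N → ℝ) 1, 0 ≤ F v)
    (hP1 : P ⊆ Icc 0 1) (hz : z ∈ Icc (0 : N → ℝ) 1) (ho : o ∈ Icc (0 : N → ℝ) 1)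
    (hts : ts ∈ Ioo (0 : ℝ) 1) {b m : ℝ} (hab : ts ≤ b) (hb : b ≤ 1)
    (hx : ∀ t ∈ Ioo ts b, m ≤ F (psum (x t) o)) :
    m * (b - ts) ≤ Real.exp b * F (psum (y b) o) - Real.exp ts * F (psum (y ts) o) := by
  obtain ⟨L, hL, hFL⟩ := hF.exists_lipschitz hdiff
  obtain ⟨K, hK, hyK⟩ := h.exists_lipschitz hP1
  have hmem : ∀ t ∈ Icc (0 : ℝ) 1, y t ∈ Icc (0 : N → ℝ) 1 := fun t ht =>
    ⟨h.nonneg hP1 hz hts ht, h.le_one hP1 hz hts ht⟩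
  have ho1 : 0 ≤ 1 - o := sub_nonneg.2 ho.2
  have hpsum : ∀ w : N → ℝ, psum w o = o + w * (1 - o) := fun w => by
    unfold psum
    ring
  have key := sub_le_exp_mul_sub (f := fun t => F (psum (y t) o)) (k := fun t => m * t) hab
    (absolutelyContinuousOnInterval_of_abs_sub_le
      (mul_nonneg hL (mul_nonneg hK (norm_nonneg (1 - o)))) hab
      fun s hs t ht hst => ?_) (by fun_prop) ?_
  · linarith
  · have hs0 := hts.1.le.trans hs.1
    have ht1 := ht.2.trans hb
    have hs01 : s ∈ Icc (0 : ℝ) 1 := ⟨hs0, hst.trans ht1⟩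
    have ht01 : t ∈ Icc (0 : ℝ) 1 := ⟨hs0.trans hst, ht1⟩
    refine (hFL _ _ (psum_mem_Icc (hmem s hs01) ho).1 ?_ (psum_mem_Icc (hmem t ht01) ho).2).trans ?_
    · rw [hpsum, hpsum]
      exact add_le_add_right (mul_le_mul_of_nonneg_right (h.mono hP1 hz hts hs0 hst ht1) ho1) _
    · rw [hpsum, hpsum, add_sub_add_left_eq_sub, ← sub_mul, mul_assoc]
      refine mul_le_mul_of_nonneg_left ((norm_mul_le _ _).trans ?_) hL
      rw [mul_right_comm]
      exact mul_le_mul_of_nonneg_right (hyK s hs01 t ht01 hst) (norm_nonneg _)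
  · filter_upwards [h.ae_hasDerivAt] with t ht htab
    have ht01 : t ∈ Ioo (0 : ℝ) 1 := ⟨hts.1.trans htab.1, htab.2.trans_le hb⟩
    have hyt := hmem t (Ioo_subset_Icc_self ht01)
    have hxt := hP1 (h.direction_mem (Ioo_subset_Ico_self ht01))
    have hd : HasDerivAt (fun t => psum (y t) o) ((1 - y t) * x t * (1 - o)) t := by
      have h1 := (ht ht01).mul_const (1 - o)
      rw [zAt, if_neg (not_lt.2 htab.1.le), sub_zero] at h1
      simpa only [hpsum] using h1.const_add o
    refine ⟨_, ((hdiff _ (psum_mem_Icc hyt ho)).hasFDerivWithinAt).comp_hasDerivAt t hd ?_, ?_⟩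
    · filter_upwards [Icc_mem_nhds ht01.1 ht01.2] with s hs using psum_mem_Icc (hmem s hs) ho
    have hxo := psum_mem_Icc hxt ho
    have hxo1 : 0 ≤ 1 - psum (x t) o := sub_nonneg.2 hxo.2
    have e : psum (y t) o + (1 - y t) * x t * (1 - o)
        = psum (x t) o + y t * (1 - psum (x t) o) := by
      unfold psum
      ring
    have h1 := hF.sub_le_fderivWithin hdiff (psum_mem_Icc hyt ho).1
      (d := (1 - y t) * x t * (1 - o))
      (mul_nonneg (mul_nonneg (sub_nonneg.2 hyt.2) hxt.1) ho1) (by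
        have e2 : psum (y t) o + (1 - y t) * x t * (1 - o) = psum (y t) (psum (x t) o) := by
          unfold psum
          ring
        rw [e2]
        exact (psum_mem_Icc hyt hxo).2)
    rw [e] at h1
    have h2 := hF.one_sub_mul_le hdiff hpos hxo.1 (mul_nonneg hyt.1 hxo1)
      (sub_nonneg.2 (Real.exp_le_one_iff.2 (neg_nonpos.2 ht01.1.le)))
      (sub_le_self 1 (Real.exp_pos _).le) fun i =>
        mul_le_mul_of_nonneg_right (h.le_one_sub_exp hP1 hz hts (Ioo_subset_Icc_self ht01) i)
          (hxo1 i)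
    have h3 : Real.exp t * Real.exp (-t) = 1 := by rw [← Real.exp_add]; simp
    have h4 := hx t htab
    have h5 : deriv (fun t => m * t) t = m := by simp
    rw [h5]
    calc m ≤ F (psum (x t) o) := h4
      _ = Real.exp t * ((1 - (1 - Real.exp (-t))) * F (psum (x t) o)) := by
        rw [sub_sub_cancel, ← mul_assoc, h3, one_mul]
      _ ≤ _ := mul_le_mul_of_nonneg_left (by linarith) (Real.exp_pos t).le

/-! ### The optimum is an allowed direction -/

/-- If the step from `y` towards `o` has at least the value `V(τ)`, then `o` is allowed, by the
concavity of `F` along this step. -/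
theorem opt_mem_allowed (h : Execution F P z ts ε vo vh vp x y) (hF : DRSubmodular F)
    (hdiff : DifferentiableOn ℝ F (Icc 0 1)) (hP1 : P ⊆ Icc 0 1) (hz : z ∈ Icc (0 : N → ℝ) 1)
    (ho : o ∈ P) (hts : ts ∈ Ioo (0 : ℝ) 1) {t : ℝ} (ht : t ∈ Icc (0 : ℝ) 1)
    (hV : threshold ts ε vo vh vp t ≤ F (y t + (1 - y t - zAt z ts t) * o)) :
    o ∈ allowed F P z ts ε vo vh vp t (y t) := by
  have hs : 0 ≤ 1 - y t - zAt z ts t := h.slack_nonneg hP1 hz hts ht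
  have h1 := hF.sub_le_fderivWithin hdiff (h.nonneg hP1 hz hts ht)
    (mul_nonneg hs (hP1 ho).1) fun i => by
      have h2 : 0 ≤ 1 - y t i - zAt z ts t i := hs i
      have h3 : o i ≤ 1 := (hP1 ho).2 i
      have h4 := zAt_nonneg (ts := ts) hz.1 t i
      simp only [Pi.add_apply, Pi.mul_apply, Pi.sub_apply, Pi.one_apply]
      nlinarith
  refine ⟨ho, ?_⟩
  rw [weight_dotProduct]
  linarith

theorem localMaxIn_of_opt_mem (h : Execution F P z ts ε vo vh vp x y) {t : ℝ}
    (ht : t ∈ Ico (0 : ℝ) 1) (ho : o ∈ allowed F P z ts ε vo vh vp t (y t)) :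
    LocalMaxIn F (allowed F P z ts ε vo vh vp t (y t)) (x t) :=
  (h.legal t ht).1 ⟨o, ho⟩

theorem opt_mem_allowed_of_lt
    (h : Execution F P z ts ε (F o) (F (z * o)) (F (psum z o)) x y) (hF : DRSubmodular F)
    (hdiff : DifferentiableOn ℝ F (Icc 0 1)) (hpos : ∀ v ∈ Icc (0 : N → ℝ) 1, 0 ≤ F v)
    (hP1 : P ⊆ Icc 0 1) (hz : z ∈ Icc (0 : N → ℝ) 1)
    (ho : o ∈ P) (hts : ts ∈ Ioo (0 : ℝ) 1) {t : ℝ} (ht : t ∈ Ico 0 ts) :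
    o ∈ allowed F P z ts ε (F o) (F (z * o)) (F (psum z o)) t (y t) := by
  have ht01 : t ∈ Icc (0 : ℝ) 1 := ⟨ht.1, (ht.2.trans hts.2).le⟩
  refine h.opt_mem_allowed hF hdiff hP1 hz ho hts ht01 ?_
  rw [threshold, if_pos ht.2, zAt, if_pos ht.2]
  exact hF.le_add_slack_mul hdiff hpos hz (hP1 ho)
    (sub_nonneg.2 (Real.exp_le_one_iff.2 (neg_nonpos.2 ht.1)))
    (sub_le_self 1 (Real.exp_pos _).le) (h.nonneg hP1 hz hts ht01)
    (h.le_one_sub_exp_mul hP1 hz.2 hts.2.le ⟨ht.1, ht.2.le⟩)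

theorem opt_mem_allowed_of_le (h : Execution F P z ts ε vo vh vp x y) (hF : DRSubmodular F)
    (hdiff : DifferentiableOn ℝ F (Icc 0 1)) (hP1 : P ⊆ Icc 0 1) (hz : z ∈ Icc (0 : N → ℝ) 1)
    (ho : o ∈ P) (hts : ts ∈ Ioo (0 : ℝ) 1) {t : ℝ} (ht : t ∈ Ico ts 1)
    (hV : threshold ts ε vo vh vp t ≤ F (psum (y t) o)) :
    o ∈ allowed F P z ts ε vo vh vp t (y t) := by
  have e : y t + (1 - y t - zAt z ts t) * o = psum (y t) o := by
    rw [zAt, if_neg (not_lt.2 ht.1), psum]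
    ring
  exact h.opt_mem_allowed hF hdiff hP1 hz ho hts ⟨hts.1.le.trans ht.1, ht.2.le⟩ (e ▸ hV)

/-- From time `ts` on, the value of `y ⊕ o` stays above the threshold, provided that any direction
which is a local maximum with respect to `o` satisfies `F(x ⊕ o) ≥ F(z ⊕ o) - ε F(o)`. -/
theorem threshold_lt_psum
    (h : Execution F P z ts ε (F o) (F (z * o)) (F (psum z o)) x y) (hF : DRSubmodular F)
    (hdiff : DifferentiableOn ℝ F (Icc 0 1)) (hpos : ∀ v ∈ Icc (0 : N → ℝ) 1, 0 ≤ F v)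
    (hP1 : P ⊆ Icc 0 1) (hz : z ∈ Icc (0 : N → ℝ) 1)
    (ho : o ∈ P) (ho0 : 0 < F o) (hts : ts ∈ Ioo (0 : ℝ) 1) (hε : 0 < ε)
    (hgood : ∀ τ ∈ Ico ts 1, LocalMaxWrt F (x τ) o →
      F (psum z o) - ε * F o ≤ F (psum (x τ) o)) {t : ℝ} (ht : t ∈ Icc ts 1) :
    threshold ts ε (F o) (F (z * o)) (F (psum z o)) t < F (psum (y t) o) := by
  let V : ℝ → ℝ := fun t => Real.exp (-t) *
    ((Real.exp ts - 2 * ε) * F o - (Real.exp ts - 1 - (t - ts)) * F (psum z o))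
  have hV : ∀ t ∈ Icc ts 1, threshold ts ε (F o) (F (z * o)) (F (psum z o)) t = V t :=
    fun t ht => by rw [threshold, if_neg (not_lt.2 ht.1)]
  have hmem : ∀ t ∈ Icc ts 1, y t ∈ Icc (0 : N → ℝ) 1 := fun t ht =>
    ⟨h.nonneg hP1 hz hts ⟨hts.1.le.trans ht.1, ht.2⟩,
      h.le_one hP1 hz hts ⟨hts.1.le.trans ht.1, ht.2⟩⟩
  -- as long as the claim holds, it holds with room to spare, since `1 * ε < 2 * ε`
  have step : ∀ t ∈ Icc ts 1, (∀ s ∈ Ico ts t, V s ≤ F (psum (y s) o)) →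
      V t < F (psum (y t) o) := by
    intro t ht hs
    have h1 := h.mul_le_exp_mul_psum_sub hF hdiff hpos hP1 hz (hP1 ho) hts ht.1 ht.2
      (m := F (psum z o) - ε * F o) fun s hst => by
        have hs1 : s ∈ Ico ts 1 := ⟨hst.1.le, hst.2.trans_le ht.2⟩
        have hmemQ := h.opt_mem_allowed_of_le hF hdiff hP1 hz ho hts hs1
          ((hV s ⟨hs1.1, hs1.2.le⟩).trans_le (hs s ⟨hst.1.le, hst.2⟩))
        exact hgood s hs1 ((h.localMaxIn_of_opt_mem ⟨hts.1.le.trans hs1.1, hs1.2⟩ hmemQ).2 o hmemQ)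
    have hts1 : ts ∈ Icc (0 : ℝ) 1 := Ioo_subset_Icc_self hts
    have h2 := hF.le_psum hdiff hpos hz (hP1 ho)
      (sub_nonneg.2 (Real.exp_le_one_iff.2 (neg_nonpos.2 hts.1.le)))
      (sub_le_self 1 (Real.exp_pos _).le) (h.nonneg hP1 hz hts hts1)
      (h.le_one_sub_exp_mul hP1 hz.2 hts.2.le (right_mem_Icc.2 hts.1.le))
    have h3 : Real.exp ts * Real.exp (-ts) = 1 := by rw [← Real.exp_add]; simp
    have h4 : Real.exp ts * F o - (Real.exp ts - 1) * F (psum z o)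
        ≤ Real.exp ts * F (psum (y ts) o) := by
      linear_combination mul_le_mul_of_nonneg_left h2 (Real.exp_pos ts).le - F (psum z o) * h3
    have h5 : 0 < ε * F o := mul_pos hε ho0
    have h6 : (Real.exp ts - 2 * ε) * F o - (Real.exp ts - 1 - (t - ts)) * F (psum z o)
        < Real.exp t * F (psum (y t) o) := by
      have : ε * F o * (t - ts) ≤ ε * F o * 1 :=
        mul_le_mul_of_nonneg_left (by linarith [ht.2, hts.1]) h5.le
      linarith
    have h7 : Real.exp (-t) * Real.exp t = 1 := by rw [← Real.exp_add]; simp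
    have h8 := mul_lt_mul_of_pos_left h6 (Real.exp_pos (-t))
    rwa [← mul_assoc, h7, one_mul] at h8
  rw [hV t ht]
  by_contra! hbad
  -- consider the first time at which the claim fails
  have hycont : ContinuousOn y (Icc ts 1) := by
    obtain ⟨K, hK, hyK⟩ := h.exists_lipschitz hP1
    have : LipschitzOnWith K.toNNReal y (Icc ts 1) :=
      LipschitzOnWith.of_dist_le_mul fun s hs r hr => by
        have hs' : s ∈ Icc (0 : ℝ) 1 := ⟨hts.1.le.trans hs.1, hs.2⟩
        have hr' : r ∈ Icc (0 : ℝ) 1 := ⟨hts.1.le.trans hr.1, hr.2⟩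
        rw [Real.coe_toNNReal _ hK]
        rcases le_total s r with hsr | hsr
        · rw [dist_comm, dist_comm s, dist_eq_norm, Real.dist_eq,
            abs_of_nonneg (sub_nonneg.2 hsr)]
          exact hyK s hs' r hr' hsr
        · rw [dist_eq_norm, Real.dist_eq, abs_of_nonneg (sub_nonneg.2 hsr)]
          exact hyK r hr' s hs' hsr
    exact this.continuousOn
  have hgcont : ContinuousOn (fun t => F (psum (y t) o) - V t) (Icc ts 1) := by
    refine ContinuousOn.sub (hdiff.continuousOn.comp (t := Icc 0 1) ?_
      fun t ht => psum_mem_Icc (hmem t ht) (hP1 ho)) (by fun_prop)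
    unfold psum
    fun_prop
  have hS : IsCompact (Icc ts 1 ∩ (fun t => F (psum (y t) o) - V t) ⁻¹' Iic 0) :=
    isCompact_Icc.of_isClosed_subset
      (hgcont.preimage_isClosed_of_isClosed isClosed_Icc isClosed_Iic) inter_subset_left
  obtain ⟨σ, ⟨hσ, hσ0⟩, hmin⟩ := hS.exists_isLeast ⟨t, ht, sub_nonpos.2 hbad⟩
  refine absurd (step σ hσ fun s hs => ?_) (not_lt.2 (sub_nonpos.1 hσ0))
  by_contra! hlt
  exact absurd (hmin ⟨⟨hs.1, hs.2.le.trans hσ.2⟩, sub_nonpos.2 hlt.le⟩) (not_le.2 hs.2)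

/-! ### The value of the output -/

/-- The value of the output, provided that every direction which is a local maximum with respect
to `o` satisfies `F(x ⊕ o) ≥ F(z ⊕ o) - ε F(o)`. -/
theorem output_value
    (h : Execution F P z ts ε (F o) (F (z * o)) (F (psum z o)) x y) (hF : DRSubmodular F)
    (hdiff : DifferentiableOn ℝ F (Icc 0 1)) (hpos : ∀ v ∈ Icc (0 : N → ℝ) 1, 0 ≤ F v)
    (hP1 : P ⊆ Icc 0 1) (hz : z ∈ Icc (0 : N → ℝ) 1)
    (ho : o ∈ P) (ho0 : 0 < F o) (hts : ts ∈ Ioo (0 : ℝ) 1) (hε : 0 < ε)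
    (hgood : ∀ τ ∈ Ico ts 1, LocalMaxWrt F (x τ) o →
      F (psum z o) - ε * F o ≤ F (psum (x τ) o)) :
    Real.exp (-1) * (((2 - ts) * Real.exp ts - 1 - 2 * ε) * F o
      - (Real.exp ts - 1) * F (z * o)
      - ((2 - ts) * Real.exp ts - (ts ^ 2 - 2 * ts + 5) / 2) * F (psum z o)) ≤ F (y 1) := by
  have h1 := h.sub_le_exp_mul_value_sub hF hdiff hP1 hz hts le_rfl hts.1.le hts.2.le
    (k := fun t => Real.exp t * (F o - F (z * o)) - (Real.exp t - t) * F (psum z o))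
    (by fun_prop) (fun t ht => by
      have hd := ((Real.hasDerivAt_exp t).mul_const (F o - F (z * o))).sub
        (((Real.hasDerivAt_exp t).sub (hasDerivAt_id t)).mul_const (F (psum z o)))
      have h3 : Real.exp t * Real.exp (-t) = 1 := by rw [← Real.exp_add]; simp
      refine hd.deriv.trans ?_
      rw [threshold, if_pos ht.2]
      linear_combination -F (psum z o) * h3)
    fun t ht => (h.localMaxIn_of_opt_mem ⟨ht.1.le, ht.2.trans hts.2⟩
      (h.opt_mem_allowed_of_lt hF hdiff hpos hP1 hz ho hts ⟨ht.1.le, ht.2⟩)).1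
  have h2 := h.sub_le_exp_mul_value_sub hF hdiff hP1 hz hts hts.1.le hts.2.le le_rfl
    (k := fun t => (Real.exp ts - 2 * ε) * F o * t
      - ((Real.exp ts - 1) * t - (t - ts) ^ 2 / 2) * F (psum z o))
    (by fun_prop) (fun t ht => by
      have hd := ((hasDerivAt_id t).const_mul ((Real.exp ts - 2 * ε) * F o)).sub
        ((((hasDerivAt_id t).const_mul (Real.exp ts - 1)).sub
          ((((hasDerivAt_id t).sub_const ts).pow 2).div_const 2)).mul_const (F (psum z o)))
      have h3 : Real.exp t * Real.exp (-t) = 1 := by rw [← Real.exp_add]; simp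
      refine hd.deriv.trans ?_
      rw [threshold, if_neg (not_lt.2 ht.1.le), ← mul_assoc, h3]
      simp)
    fun t ht => by
      exact (h.localMaxIn_of_opt_mem ⟨hts.1.le.trans ht.1.le, ht.2⟩
        (h.opt_mem_allowed_of_le hF hdiff hP1 hz ho hts ⟨ht.1.le, ht.2⟩
          (h.threshold_lt_psum hF hdiff hpos hP1 hz ho ho0 hts hε hgood
            ⟨ht.1.le, ht.2.le⟩).le)).1
  have h3 : 0 ≤ F (y 0) := by
    rw [h.start_eq_zero]
    exact hpos 0 ⟨le_rfl, zero_le_one⟩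
  have h4 : 0 ≤ ε * F o * ts := (mul_pos (mul_pos hε ho0) hts.1).le
  rw [Real.exp_neg, inv_mul_le_iff₀ (Real.exp_pos 1)]
  simp only [Real.exp_zero] at h1
  linarith

end Execution

end FWMCG

theorem theorem5p1 :
    ∃ C : ℝ, 0 < C ∧
      ∀ (N : Type u) [Fintype N] [DecidableEq N]
        (F : (N → ℝ) → ℝ) (P : Set (N → ℝ)) (z o : N → ℝ) (ts ε : ℝ),
        -- the objective: non-negative, differentiable and DR-submodular on the cube
        (∀ v ∈ Set.Icc (0 : N → ℝ) 1, 0 ≤ F v) →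
        DifferentiableOn ℝ F (Set.Icc (0 : N → ℝ) 1) →
        FWMCG.DRSubmodular F →
        -- the feasible region: a down-closed convex body inside of the cube
        P ⊆ Set.Icc (0 : N → ℝ) 1 → Convex ℝ P → IsCompact P → FWMCG.DownClosed P →
        -- an optimal solution, of positive value
        o ∈ P → (∀ v ∈ P, F v ≤ F o) → 0 < F o →
        -- the input of the algorithm
        z ∈ P → ts ∈ Set.Ioo (0 : ℝ) 1 → ε ∈ Set.Ioo (0 : ℝ) (1 / 2) →
        -- at any time, and whatever the current solution is, a legal direction exists
        (∀ τ ∈ Set.Ico (0 : ℝ) 1, ∀ w ∈ Set.Icc (0 : N → ℝ) 1, ∃ v,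
          FWMCG.LegalDirection F P z ts ε (F o) (F (z * o)) (F (FWMCG.psum z o)) τ w v) ∧
        -- the guarantee for the output of every execution
        ∀ x y : ℝ → N → ℝ,
          FWMCG.Execution F P z ts ε (F o) (F (z * o)) (F (FWMCG.psum z o)) x y →
            y 1 ∈ P ∧ (∀ τ ∈ Set.Ico (0 : ℝ) 1, x τ ∈ P) ∧
            (F (y 1) ≥ Real.exp (-1) *
                (((2 - ts) * Real.exp ts - 1 - C * ε) * F o
                  - (Real.exp ts - 1) * F (z * o)
                  - ((2 - ts) * Real.exp ts - (ts ^ 2 - 2 * ts + 5) / 2)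
                      * F (FWMCG.psum z o)) ∨
              ∃ τ ∈ Set.Ico ts 1,
                F (FWMCG.psum (x τ) o) ≤ F (FWMCG.psum z o) - ε * F o ∧
                FWMCG.LocalMaxWrt F (x τ) o) := by
  refine ⟨2, two_pos, ?_⟩
  intro N _ _ F P z o ts ε hpos hdiff hF hP1 hconv hcomp hdown ho _ ho0 hz hts hε
  refine ⟨fun τ _ w _ => FWMCG.exists_legalDirection hdiff hP1 hconv hcomp ⟨o, ho⟩ _ _ _ _ _ _ _ _,
    fun x y h => ⟨h.output_mem hP1 hconv hcomp hdown (hP1 hz) hts, fun τ hτ => h.direction_mem hτ,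
      ?_⟩⟩
  by_cases hbad : ∃ τ ∈ Ico ts 1, F (FWMCG.psum (x τ) o) ≤ F (FWMCG.psum z o) - ε * F o ∧
      FWMCG.LocalMaxWrt F (x τ) o
  · exact Or.inr hbad
  · push Not at hbad
    refine Or.inl (h.output_value hF hdiff hpos hP1 (hP1 hz) ho ho0 hts hε.1 fun τ hτ hloc => ?_)
    by_contra! hlt
    exact hbad τ hτ hlt.le hloc
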